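/- For $x\in\mathbb{R}^n$ and an integer $0\le k\le n$, let $x_{tail(k)}$ denote $x$ with its $k$ largest entries in absolute value (ties broken by index) replaced by $0$. There is a universal constant $C>0$ such that the following holds for all integers $n$ and all real $\varepsilon$ with $0<\varepsilon<1/2$ and $1/\varepsilon^2<n/2$. Put $k=\lceil 1/\varepsilon^2\rceil$. There are an integer $m\le C\varepsilon^{-2}\log n$, a matrix $A\in\mathbb{R}^{m\times n}$, and a recovery map $R:\mathbb{R}^m\to\mathbb{R}^n$ such that for every $x\in\mathbb{R}^n$ the vector $R(Ax)$ is a vector of least $\ell_1$ norm among all $z\in\mathbb{R}^n$ with $Az=Ax$, it satisfies the $\ell_2/\ell_1$ recovery guarantee $$\|x-R(Ax)\|_2\le\varepsilon\,\|x_{tail(k)}\|_1,$$ and the estimation procedure $Out(Ax,Ay)=\langle R(Ax),R(Ay)\rangle$ satisfies, for all $x,y\in\mathbb{R}^n$ simultaneously, $$\bigl|Out(Ax,Ay)-\langle x,y\rangle\bigr|\le\varepsilon\bigl(\|x\|_2\,\|y_{tail(k)}\|_1+\|x_{tail(k)}\|_1\,\|y\|_2\bigr)+\varepsilon^2\,\|x_{tail(k)}\|_1\,\|y_{tail(k)}\|_1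 .$$ -/

import Mathlib

open scoped Matrix

/-- The `ℓ₁` norm of a real vector. -/
noncomputable def l1norm {n : ℕ} (x : Fin n → ℝ) : ℝ := ‖WithLp.toLp 1 x‖

/-- The `ℓ₂` (Euclidean) norm of a real vector. -/
noncomputable def l2norm {n : ℕ} (x : Fin n → ℝ) : ℝ := ‖WithLp.toLp 2 x‖

/-- `x_S`: the vector that agrees with `x` on `S` and is `0` outside `S`. -/
def restrictTo {n : ℕ} (x : Fin n → ℝ) (S : Finset (Fin n)) : Fin n → ℝ :=
  fun i => if i ∈ S then x i else 0

/-- `head(x, k)`: the `k` largest coordinates of `x` in absolute value, ties being broken by index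
(the coordinates are sorted by decreasing absolute value and the first `k` are kept). -/
noncomputable def head {n : ℕ} (x : Fin n → ℝ) (k : ℕ) : Finset (Fin n) :=
  Finset.univ.filter fun i => ((Tuple.sort fun j => -|x j|).symm i : ℕ) < k

/-- `tail(x, k) = [n] \ head(x, k)`. -/
noncomputable def tail {n : ℕ} (x : Fin n → ℝ) (k : ℕ) : Finset (Fin n) := (head x k)ᶜ

/-- `x_{tail(k)}`: `x` with its `k` largest entries in absolute value replaced by `0`. -/
noncomputable def tailVec {n : ℕ} (x : Fin n → ℝ) (k : ℕ) : Fin n → ℝ := restrictTo x (tail x k)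

/-- `R` is the `ℓ₁`-minimization recovery procedure of the measurement matrix `A`: given a sketch
`A x`, it returns a vector of least `ℓ₁` norm among all the vectors with that sketch. -/
def IsL1MinRecovery {m n : ℕ} (A : Matrix (Fin m) (Fin n) ℝ)
    (R : (Fin m → ℝ) → (Fin n → ℝ)) : Prop :=
  ∀ x : Fin n → ℝ, A *ᵥ R (A *ᵥ x) = A *ᵥ x ∧
    ∀ z : Fin n → ℝ, A *ᵥ z = A *ᵥ x → l1norm (R (A *ᵥ x)) ≤ l1norm z

/-- Sanity check: the `ℓ₁` norm as a sum. -/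
theorem l1norm_eq {n : ℕ} (x : Fin n → ℝ) : l1norm x = ∑ i, |x i| := by
  have h := PiLp.norm_eq_of_nat (p := 1) 1 (by norm_num) (WithLp.toLp 1 x)
  simpa [l1norm] using h

/-- Sanity check: the `ℓ₂` norm as a root of a sum of squares. -/
theorem l2norm_eq {n : ℕ} (x : Fin n → ℝ) : l2norm x = √(∑ i, x i ^ 2) := by
  simp [l2norm, EuclideanSpace.norm_eq]

/-- Sanity check: `head x k` has exactly `k` elements when `k ≤ n`. -/
theorem card_head {n : ℕ} (x : Fin n → ℝ) {k : ℕ} (hk : k ≤ n) : (head x k).card = k := by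
  have h : head x k = (Finset.univ.filter fun i : Fin n => (i : ℕ) < k).map
      (Tuple.sort fun j => -|x j|).toEmbedding := by
    ext i
    simp [head]
  rw [h, Finset.card_map, Fin.card_filter_val_lt, min_eq_right hk]

/-- Sanity check: every coordinate in the head is at least as large as every one outside. -/
theorem abs_le_abs_of_mem_head {n : ℕ} (x : Fin n → ℝ) (k : ℕ) {i j : Fin n}
    (hi : i ∈ head x k) (hj : j ∉ head x k) : |x j| ≤ |x i| := by
  simp only [head, Finset.mem_filter, Finset.mem_univ, true_and, not_lt] at hi hj
  have h := Tuple.monotone_sort (fun j => -|x j|)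
    (show (Tuple.sort fun j => -|x j|).symm i ≤ (Tuple.sort fun j => -|x j|).symm j from
      Fin.le_def.mpr (hi.le.trans hj))
  simpa using h

/-! Everything reduces to a sign matrix `A` whose kernel vectors `h` are spread out: `16 k ‖h‖₂² ≤
‖h‖₁²`. For an `ℓ₁` minimizer, the error `h` lies in the kernel, its mass on the head of `x` is at
most `‖h‖₁ / 4`, and minimality bounds `‖h‖₁` by four times the tail of `x`. Expanding the inner
product then gives the estimate.

The kernel property needs only a one-sided bound. By exponential moments and a union bound, some `A`
has `‖A z‖² ≥ (m/4) ‖z‖²` for all `(2n)^s` sums `z` of `s` signed basis vectors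
(`exists_signMatrix_lower_bound`). Given `h` in the kernel, Maurey's lemma (`exists_sum_approx`)
picks such a `z` near `s h / ‖h‖₁` in the norm `‖A u‖² + m ‖u‖²`. As `A h = 0`, this makes `A z`
small, hence `z` small, hence `h` small in `ℓ₂`. -/

/-- The sign `±1` of a Boolean. -/
def boolSign (b : Bool) : ℝ := if b then 1 else -1

theorem boolSign_mul_self (b : Bool) : boolSign b * boolSign b = 1 := by
  cases b <;> simp [boolSign]

theorem sum_bool_pi_succ {n : ℕ} (F : (Fin (n + 1) → Bool) → ℝ) :
    ∑ σ, F σ = ∑ τ : Fin n → Bool, (F (Fin.cons true τ) + F (Fin.cons false τ)) := by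
  rw [← (Fin.consEquiv fun _ : Fin (n + 1) => Bool).sum_comp, Fintype.sum_prod_type,
    Fintype.sum_bool, Finset.sum_add_distrib]
  rfl

/-! ### Moments and Laplace transform of Rademacher sums -/

/-- The second moment of a Rademacher sum. -/
theorem sum_rademacher_sq {n : ℕ} (z : Fin n → ℝ) :
    ∑ σ : Fin n → Bool, (∑ i, boolSign (σ i) * z i) ^ 2 = 2 ^ n * ∑ i, z i ^ 2 := by
  induction n with
  | zero => simp
  | succ n ih =>
    rw [sum_bool_pi_succ]
    simp only [Fin.sum_univ_succ, Fin.cons_zero, Fin.cons_succ]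
    have h : ∀ τ : Fin n → Bool,
        (boolSign true * z 0 + ∑ i, boolSign (τ i) * z i.succ) ^ 2 +
          (boolSign false * z 0 + ∑ i, boolSign (τ i) * z i.succ) ^ 2 =
        2 * z 0 ^ 2 + 2 * (∑ i, boolSign (τ i) * z i.succ) ^ 2 := by
      intro τ
      simp only [boolSign]
      norm_num
      ring
    rw [Finset.sum_congr rfl fun τ _ => h τ, Finset.sum_add_distrib, ← Finset.mul_sum,
      ← Finset.mul_sum, ih fun i => z i.succ]
    simp
    ring

/-- The fourth moment of a Rademacher sum. -/
theorem sum_rademacher_pow_four_le {n : ℕ} (z : Fin n → ℝ) :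
    ∑ σ : Fin n → Bool, (∑ i, boolSign (σ i) * z i) ^ 4 ≤ 2 ^ n * (3 * (∑ i, z i ^ 2) ^ 2) := by
  induction n with
  | zero => simp
  | succ n ih =>
    rw [sum_bool_pi_succ]
    simp only [Fin.sum_univ_succ, Fin.cons_zero, Fin.cons_succ]
    have h : ∀ τ : Fin n → Bool,
        (boolSign true * z 0 + ∑ i, boolSign (τ i) * z i.succ) ^ 4 +
          (boolSign false * z 0 + ∑ i, boolSign (τ i) * z i.succ) ^ 4 =
        2 * z 0 ^ 4 + 12 * z 0 ^ 2 * (∑ i, boolSign (τ i) * z i.succ) ^ 2 +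
          2 * (∑ i, boolSign (τ i) * z i.succ) ^ 4 := by
      intro τ
      simp only [boolSign]
      norm_num
      ring
    rw [Finset.sum_congr rfl fun τ _ => h τ, Finset.sum_add_distrib, Finset.sum_add_distrib,
      ← Finset.mul_sum, ← Finset.mul_sum, ← Finset.mul_sum, sum_rademacher_sq fun i => z i.succ]
    have h4 := ih fun i => z i.succ
    -- The slack in the induction step is four times this quantity.
    have hpos : (0 : ℝ) ≤ 2 ^ n * z 0 ^ 4 := by positivity
    simp only [Finset.sum_const, Finset.card_univ, Fintype.card_pi, Fintype.card_bool,
      Finset.prod_const, Fintype.card_fin, nsmul_eq_mul, Nat.cast_pow, Nat.cast_ofNat, pow_succ (2 : ℝ) n]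
    nlinarith

/-- `(1 - u + u²/2)(1 + u + u²/2) = 1 + u⁴/4 ≥ 1`, and the second factor is at most `exp u`. -/
theorem exp_neg_le_quadratic {u : ℝ} (hu : 0 ≤ u) : Real.exp (-u) ≤ 1 - u + u ^ 2 / 2 := by
  have h1 := Real.quadratic_le_exp_of_nonneg hu
  have h2 : 0 < 1 + u + u ^ 2 / 2 := by positivity
  rw [Real.exp_neg, inv_le_comm₀ (Real.exp_pos u) (by nlinarith [sq_nonneg (u - 1)])]
  refine le_trans ?_ h1
  rw [inv_le_iff_one_le_mul₀ (by nlinarith [sq_nonneg (u - 1)])]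
  nlinarith [sq_nonneg (u ^ 2)]

/-- The Laplace transform of the square of a normalised Rademacher sum. -/
theorem sum_exp_neg_rademacher_sq_le {n : ℕ} (z : Fin n → ℝ) (hz : 0 < ∑ i, z i ^ 2) :
    ∑ σ : Fin n → Bool,
        Real.exp (-((∑ i, boolSign (σ i) * z i) ^ 2 / (3 * ∑ i, z i ^ 2))) ≤
      2 ^ n * Real.exp (-(1 / 6)) := by
  set v := ∑ i, z i ^ 2 with hv
  have h1 : ∀ σ : Fin n → Bool,
      Real.exp (-((∑ i, boolSign (σ i) * z i) ^ 2 / (3 * v))) ≤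
        1 - 1 / (3 * v) * (∑ i, boolSign (σ i) * z i) ^ 2 +
          1 / (18 * v ^ 2) * (∑ i, boolSign (σ i) * z i) ^ 4 := by
    intro σ
    refine (exp_neg_le_quadratic (by positivity)).trans (le_of_eq ?_)
    field_simp
    ring
  refine (Finset.sum_le_sum fun σ _ => h1 σ).trans ?_
  rw [Finset.sum_add_distrib, Finset.sum_sub_distrib, ← Finset.mul_sum, ← Finset.mul_sum,
    sum_rademacher_sq, ← hv]
  have h4 := mul_le_mul_of_nonneg_left (sum_rademacher_pow_four_le z)
    (show 0 ≤ 1 / (18 * v ^ 2) by positivity)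
  rw [← hv] at h4
  have e4 : 1 / (18 * v ^ 2) * (2 ^ n * (3 * v ^ 2)) = 2 ^ n * (1 / 6) := by
    field_simp
    norm_num
  have e2 : 1 / (3 * v) * (2 ^ n * v) = 2 ^ n * (1 / 3) := by
    field_simp
  rw [e4] at h4
  rw [e2]
  have e0 : ∑ _σ : Fin n → Bool, (1 : ℝ) = 2 ^ n := by simp
  rw [e0]
  have h6 := mul_le_mul_of_nonneg_left (Real.add_one_le_exp (-(1 / 6) : ℝ))
    (show (0 : ℝ) ≤ 2 ^ n by positivity)
  linarith

/-! ### Lower bounds for random sign matrices -/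

/-- The matrix of signs given by an array of Booleans. -/
def signMatrix {m n : ℕ} (σ : Fin m → Fin n → Bool) : Matrix (Fin m) (Fin n) ℝ :=
  Matrix.of fun i j => boolSign (σ i j)

/-- A union bound: some sign matrix is bounded below on every vector of a finite family. -/
theorem exists_signMatrix_lower_bound {m n : ℕ} {ι : Type*} [Fintype ι] (z : ι → Fin n → ℝ)
    {M : ℝ} (hM : Real.log M ≤ m / 12) (hM0 : 0 < M) (hcard : (Fintype.card ι : ℝ) ≤ M) :
    ∃ σ : Fin m → Fin n → Bool, ∀ a : ι,
      m / 4 * ∑ j, z a j ^ 2 ≤ ∑ i, (signMatrix σ *ᵥ z a) i ^ 2 := by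
  classical
  let v : ι → ℝ := fun a => ∑ j, z a j ^ 2
  let X : (Fin n → Bool) → ι → ℝ := fun τ a => ∑ j, boolSign (τ j) * z a j
  -- Zero vectors satisfy the bound trivially, so they are given weight `0`.
  let F : (Fin m → Fin n → Bool) → ι → ℝ := fun σ a =>
    if 0 < v a then Real.exp (-((∑ i, X (σ i) a ^ 2) / (3 * v a))) else 0
  have hF0 : ∀ σ a, 0 ≤ F σ a := by
    intro σ a
    simp only [F]
    split_ifs <;> positivity
  have hFa : ∀ a, ∑ σ, F σ a ≤ 2 ^ (n * m) * Real.exp (-(m / 6)) := by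
    intro a
    by_cases ha : 0 < v a
    · have e : ∀ σ, F σ a = ∏ i, Real.exp (-(X (σ i) a ^ 2 / (3 * v a))) := by
        intro σ
        simp only [F, if_pos ha, ← Real.exp_sum, Finset.sum_neg_distrib, Finset.sum_div]
      simp only [e]
      rw [← Fintype.sum_pow (fun τ => Real.exp (-(X τ a ^ 2 / (3 * v a)))) m]
      calc _ ≤ (2 ^ n * Real.exp (-(1 / 6))) ^ m :=
            pow_le_pow_left₀ (by positivity) (sum_exp_neg_rademacher_sq_le (z a) ha) m
        _ = _ := by
            rw [mul_pow, ← pow_mul, ← Real.exp_nat_mul]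
            ring_nf
    · simp only [F, if_neg ha, Finset.sum_const_zero]
      positivity
  have htot : ∑ σ : Fin m → Fin n → Bool, ∑ a, F σ a ≤
      ∑ _σ : Fin m → Fin n → Bool, M * Real.exp (-(m / 6)) := by
    rw [Finset.sum_comm]
    refine (Finset.sum_le_sum fun a _ => hFa a).trans ?_
    simp only [Finset.sum_const, Finset.card_univ, Fintype.card_pi, Fintype.card_bool,
      Finset.prod_const, Fintype.card_fin, nsmul_eq_mul, Nat.cast_pow, Nat.cast_ofNat]
    rw [← pow_mul, mul_left_comm]
    gcongr
  obtain ⟨σ, -, hσ⟩ := Finset.exists_le_of_sum_le Finset.univ_nonempty htot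
  refine ⟨σ, fun a => ?_⟩
  have hX : ∑ i, (signMatrix σ *ᵥ z a) i ^ 2 = ∑ i, X (σ i) a ^ 2 := by
    simp [X, signMatrix, Matrix.mulVec, dotProduct]
  rw [hX]
  change m / 4 * v a ≤ _
  by_cases ha : 0 < v a
  · have h1 : F σ a ≤ M * Real.exp (-(m / 6)) :=
      (Finset.single_le_sum (fun b _ => hF0 σ b) (Finset.mem_univ a)).trans hσ
    simp only [F, if_pos ha] at h1
    have h2 := Real.log_le_log (Real.exp_pos _) h1
    rw [Real.log_mul hM0.ne' (Real.exp_pos _).ne', Real.log_exp, Real.log_exp] at h2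
    -- The union bound costs `log M ≤ m / 12` out of the exponent `m / 6`.
    have h3 : (m : ℝ) / 12 ≤ (∑ i, X (σ i) a ^ 2) / (3 * v a) := by linarith
    rw [le_div_iff₀ (by positivity)] at h3
    linarith
  · have h0 : v a ≤ 0 := not_lt.mp ha
    have hm : (m : ℝ) / 4 * v a ≤ 0 := mul_nonpos_of_nonneg_of_nonpos (by positivity) h0
    exact hm.trans (by positivity)

/-! ### Maurey approximation and the kernel -/

/-- Greedy form of Maurey's lemma: sums of `s` points approximate `s` times a convex combination. -/
theorem exists_sum_approx {E ι : Type*} [NormedAddCommGroup E] [InnerProductSpace ℝ E] [Fintype ι]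
    (p : ι → ℝ) (v : ι → E) (x : E) {B : ℝ} (hp : ∀ i, 0 ≤ p i) (hsum : ∑ i, p i = 1)
    (hx : ∑ i, p i • v i = x) (hB : ∀ i, ‖v i‖ ≤ B) (s : ℕ) :
    ∃ w : Fin s → ι, ‖∑ j, v (w j) - (s : ℝ) • x‖ ^ 2 ≤ s * (4 * B ^ 2) := by
  have hxB : ‖x‖ ≤ B := by
    rw [← hx]
    calc ‖∑ i, p i • v i‖ ≤ ∑ i, ‖p i • v i‖ := norm_sum_le _ _
      _ ≤ ∑ i, p i * B := by
        refine Finset.sum_le_sum fun i _ => ?_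
        rw [norm_smul, Real.norm_of_nonneg (hp i)]
        exact mul_le_mul_of_nonneg_left (hB i) (hp i)
      _ = B := by rw [← Finset.sum_mul, hsum, one_mul]
  induction s with
  | zero => exact ⟨Fin.elim0, by simp⟩
  | succ s ih =>
    obtain ⟨w, hw⟩ := ih
    set u := ∑ j, v (w j) - (s : ℝ) • x with hu
    -- These inner products have `p`-average zero, so one is nonpositive; adding that point leaves
    -- no positive cross term.
    have hi : ∃ i, inner ℝ u (v i - x) ≤ 0 := by
      by_contra! hcon
      have h0 : ∑ i, p i * inner ℝ u (v i - x) = 0 := by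
        simp only [← real_inner_smul_right, ← inner_sum, smul_sub, Finset.sum_sub_distrib, hx,
          ← Finset.sum_smul, hsum, one_smul, sub_self, inner_zero_right]
      have h1 : ∀ i ∈ Finset.univ, p i * inner ℝ u (v i - x) = 0 :=
        (Finset.sum_eq_zero_iff_of_nonneg fun i _ => mul_nonneg (hp i) (hcon i).le).mp h0
      have h2 : ∀ i, p i = 0 := fun i =>
        (mul_eq_zero.mp (h1 i (Finset.mem_univ i))).resolve_right (hcon i).ne'
      simp [h2] at hsum
    obtain ⟨i, hi⟩ := hi
    refine ⟨Fin.cons i w, ?_⟩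
    have e : ∑ j, v ((Fin.cons i w : Fin (s + 1) → ι) j) - ((s + 1 : ℕ) : ℝ) • x =
        u + (v i - x) := by
      rw [Fin.sum_univ_succ]
      simp only [Fin.cons_zero, Fin.cons_succ, hu]
      push_cast
      module
    rw [e, norm_add_sq_real]
    have h3 : ‖v i - x‖ ≤ 2 * B := (norm_sub_le _ _).trans (by linarith [hB i])
    have h4 : ‖v i - x‖ ^ 2 ≤ (2 * B) ^ 2 := pow_le_pow_left₀ (norm_nonneg _) h3 2
    push_cast
    linarith

/-- The map `u ↦ (A u, c u)` into Euclidean space. -/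
noncomputable def augmentedMap {m n : ℕ} (A : Matrix (Fin m) (Fin n) ℝ) (c : ℝ) :
    (Fin n → ℝ) →ₗ[ℝ] EuclideanSpace ℝ (Fin m ⊕ Fin n) where
  toFun u := WithLp.toLp 2 (Sum.elim (A *ᵥ u) (c • u))
  map_add' u v := by
    ext (i | i)
    · simp [Matrix.mulVec_add]
    · simp
  map_smul' r u := by
    ext (i | i)
    · simp [Matrix.mulVec_smul]
    · simp [mul_left_comm]

theorem norm_augmentedMap_sq {m n : ℕ} (A : Matrix (Fin m) (Fin n) ℝ) (c : ℝ) (u : Fin n → ℝ) :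
    ‖augmentedMap A c u‖ ^ 2 = ∑ i, (A *ᵥ u) i ^ 2 + c ^ 2 * ∑ j, u j ^ 2 := by
  simp [EuclideanSpace.norm_sq_eq, augmentedMap, mul_pow, Finset.mul_sum]

/-- Some sign matrix has a kernel consisting of vectors with small `ℓ₂/ℓ₁` ratio. -/
theorem exists_signMatrix_kernel {m n s : ℕ} (hm : 0 < m) (hn : 0 < n)
    (hs : s * Real.log (2 * n) ≤ m / 12) :
    ∃ σ : Fin m → Fin n → Bool, ∀ h : Fin n → ℝ, signMatrix σ *ᵥ h = 0 →
      s * ∑ j, h j ^ 2 ≤ 40 * (∑ j, |h j|) ^ 2 := by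
  let e : Fin n × Bool → Fin n → ℝ := fun a => Pi.single a.1 (boolSign a.2)
  obtain ⟨σ, hσ⟩ := exists_signMatrix_lower_bound (m := m)
    (fun a : Fin s → Fin n × Bool => ∑ t, e (a t)) (M := (2 * n : ℝ) ^ s)
    (by rw [Real.log_pow]; exact hs) (by positivity) (by simp [mul_comm])
  refine ⟨σ, fun h hh => ?_⟩
  set A := signMatrix σ
  set L := ∑ j, |h j| with hL
  have hL0 : 0 ≤ L := Finset.sum_nonneg fun j _ => abs_nonneg _
  rcases hL0.eq_or_lt with h0 | hLpos
  · have hz : ∀ j, h j = 0 := fun j => abs_eq_zero.mp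
      ((Finset.sum_eq_zero_iff_of_nonneg fun j _ => abs_nonneg (h j)).mp h0.symm j
        (Finset.mem_univ j))
    simp only [hz, ne_eq, OfNat.ofNat_ne_zero, not_false_eq_true, zero_pow, Finset.sum_const_zero,
      mul_zero]
    positivity
  rcases Nat.eq_zero_or_pos s with rfl | hspos
  · simp only [Nat.cast_zero, zero_mul]
    positivity
  have hm' : (0 : ℝ) < m := by exact_mod_cast hm
  have hs' : (0 : ℝ) < s := by exact_mod_cast hspos
  -- With `c = √m`, both components of a signed basis vector's image have squared norm `m`.
  let Φ := augmentedMap A √m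
  have hB : ∀ a, ‖Φ (e a)‖ ≤ √(2 * m) := by
    intro a
    apply Real.le_sqrt_of_sq_le
    rw [norm_augmentedMap_sq, Real.sq_sqrt hm'.le]
    have h1 : ∑ j, e a j ^ 2 = 1 := by
      rw [Finset.sum_eq_single a.1]
      · simp [e, sq, boolSign_mul_self]
      · intro j _ hj
        simp [e, hj]
      · simp
    have h2 : ∑ i, (A *ᵥ e a) i ^ 2 = m := by
      have h3 : ∀ i, (A *ᵥ e a) i ^ 2 = 1 := by
        intro i
        have h4 : (A *ᵥ e a) i = boolSign (σ i a.1) * boolSign a.2 := by simp [e, A, signMatrix]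
        rw [h4, sq, mul_mul_mul_comm, boolSign_mul_self, boolSign_mul_self, one_mul]
      simp [h3]
    rw [h1, h2]
    linarith
  have hsign : ∀ j, |h j| * boolSign (decide (0 ≤ h j)) = h j := by
    intro j
    by_cases hj : 0 ≤ h j
    · simp [boolSign, hj, abs_of_nonneg]
    · simp [boolSign, hj, abs_of_neg (not_le.mp hj)]
  have hx : ∑ j, (|h j| / L) • Φ (e (j, decide (0 ≤ h j))) = Φ (L⁻¹ • h) := by
    simp only [← map_smul, ← map_sum]
    congr 1
    ext i
    rw [Finset.sum_apply, Finset.sum_eq_single i]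
    · simp only [e, Pi.smul_apply, Pi.single_eq_same, smul_eq_mul]
      rw [div_mul_eq_mul_div, hsign]
      ring
    · intro j _ hj
      simp [e, hj.symm]
    · simp
  obtain ⟨w, hw⟩ := exists_sum_approx (fun j => |h j| / L)
    (fun j => Φ (e (j, decide (0 ≤ h j)))) _ (fun j => by positivity)
    (by rw [← Finset.sum_div, ← hL, div_self hLpos.ne']) hx (fun j => hB _) s
  have hlow := hσ fun t => (w t, decide (0 ≤ h (w t)))
  set z : Fin n → ℝ := ∑ t, e (w t, decide (0 ≤ h (w t))) with hz
  rw [← map_sum, ← map_smul, ← map_sub, norm_augmentedMap_sq, Real.sq_sqrt hm'.le,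
    Real.sq_sqrt (by positivity), ← hz, Matrix.mulVec_sub, Matrix.mulVec_smul, Matrix.mulVec_smul,
    hh, smul_zero, smul_zero, sub_zero] at hw
  have h1 : (1 / 4 : ℝ) * ∑ j, z j ^ 2 + ∑ j, (z - (s : ℝ) • L⁻¹ • h) j ^ 2 ≤ 8 * s := by
    refine le_of_mul_le_mul_left ?_ hm'
    linarith
  -- Weighted Cauchy–Schwarz: `(a + b)² ≤ (4 + 1)(a²/4 + b²)`.
  have h2 : ∑ j, (s / L * h j) ^ 2 ≤
      5 * ((1 / 4 : ℝ) * ∑ j, z j ^ 2 + ∑ j, (z - (s : ℝ) • L⁻¹ • h) j ^ 2) := by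
    rw [Finset.mul_sum, ← Finset.sum_add_distrib, Finset.mul_sum]
    refine Finset.sum_le_sum fun j _ => ?_
    have e1 : (z - (s : ℝ) • L⁻¹ • h) j = z j - s / L * h j := by
      simp only [Pi.sub_apply, Pi.smul_apply, smul_eq_mul]
      ring
    rw [e1]
    nlinarith [sq_nonneg (5 * z j - 4 * (s / L * h j))]
  have h3 : s ^ 2 * ∑ j, h j ^ 2 ≤ s * (40 * L ^ 2) := by
    have h4 := h2.trans (mul_le_mul_of_nonneg_left h1 (by norm_num))
    simp only [mul_pow, div_pow, ← Finset.mul_sum] at h4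
    rw [div_mul_eq_mul_div, div_le_iff₀ (by positivity)] at h4
    linarith
  rw [sq, mul_assoc] at h3
  exact le_of_mul_le_mul_left h3 hs'

/-! ### `ℓ₁` minimization -/

/-- `ℓ₁`-minimization recovery exists for every matrix. -/
theorem exists_isL1MinRecovery {m n : ℕ} (A : Matrix (Fin m) (Fin n) ℝ) :
    ∃ R, IsL1MinRecovery A R := by
  classical
  have key : ∀ y : Fin m → ℝ, ∃ r : Fin n → ℝ, (∃ x, A *ᵥ x = y) →
      A *ᵥ r = y ∧ ∀ z, A *ᵥ z = y → l1norm r ≤ l1norm z := by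
    intro y
    by_cases hy : ∃ x, A *ᵥ x = y
    · obtain ⟨x, hx⟩ := hy
      let S : Set (PiLp 1 fun _ : Fin n => ℝ) := {u | A *ᵥ WithLp.ofLp u = y}
      have hS : IsClosed S := by
        refine isClosed_eq ?_ continuous_const
        exact (Continuous.matrix_mulVec continuous_const (PiLp.continuous_ofLp 1 _))
      have hne : S.Nonempty := ⟨WithLp.toLp 1 x, hx⟩
      -- A closed set in finite dimension contains a point nearest to the origin.
      obtain ⟨r, hr, hd⟩ := hS.exists_infDist_eq_dist hne 0
      refine ⟨WithLp.ofLp r, fun _ => ⟨hr, fun z hz => ?_⟩⟩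
      have h1 : Metric.infDist 0 S ≤ dist 0 (WithLp.toLp 1 z : PiLp 1 fun _ : Fin n => ℝ) :=
        Metric.infDist_le_dist_of_mem hz
      rw [hd, dist_zero_left, dist_zero_left] at h1
      exact h1
    · exact ⟨0, fun h => absurd h hy⟩
  choose R hR using key
  exact ⟨R, fun x => hR _ ⟨x, rfl⟩⟩

theorem l2norm_sq {n : ℕ} (x : Fin n → ℝ) : l2norm x ^ 2 = ∑ i, x i ^ 2 := by
  rw [l2norm_eq, Real.sq_sqrt (Finset.sum_nonneg fun i _ => sq_nonneg _)]

theorem l2norm_nonneg {n : ℕ} (x : Fin n → ℝ) : 0 ≤ l2norm x := norm_nonneg _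

theorem l1norm_nonneg {n : ℕ} (x : Fin n → ℝ) : 0 ≤ l1norm x := norm_nonneg _

theorem abs_dotProduct_le_l2norm_mul {n : ℕ} (x y : Fin n → ℝ) :
    |x ⬝ᵥ y| ≤ l2norm x * l2norm y := by
  apply abs_le_of_sq_le_sq _ (mul_nonneg (l2norm_nonneg x) (l2norm_nonneg y))
  rw [mul_pow, l2norm_sq, l2norm_sq]
  exact Finset.sum_mul_sq_le_sq_mul_sq _ _ _

theorem l1norm_tailVec {n : ℕ} (x : Fin n → ℝ) (k : ℕ) :
    l1norm (tailVec x k) = ∑ i ∈ (head x k)ᶜ, |x i| := by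
  rw [l1norm_eq]
  simp only [tailVec, restrictTo, apply_ite abs, abs_zero, Finset.sum_ite_mem, Finset.univ_inter]
  rfl

/-- If vectors in the kernel of `A` have small `ℓ₂/ℓ₁` ratio, `ℓ₁`-minimization achieves the
`ℓ₂/ℓ₁` recovery guarantee. -/
theorem l2norm_sub_recovery_le {m n k : ℕ} {A : Matrix (Fin m) (Fin n) ℝ}
    {R : (Fin m → ℝ) → (Fin n → ℝ)} (hR : IsL1MinRecovery A R) (hkn : k ≤ n)
    (hA : ∀ h : Fin n → ℝ, A *ᵥ h = 0 → 16 * k * ∑ j, h j ^ 2 ≤ (∑ j, |h j|) ^ 2)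
    (x : Fin n → ℝ) :
    √k * l2norm (x - R (A *ᵥ x)) ≤ l1norm (tailVec x k) := by
  obtain ⟨hR1, hR2⟩ := hR x
  set r := R (A *ᵥ x)
  set h := x - r with hh
  have hAh : A *ᵥ h = 0 := by rw [hh, Matrix.mulVec_sub, hR1, sub_self]
  have hker := hA h hAh
  set S := head x k
  set L := ∑ j, |h j|
  have hL0 : 0 ≤ L := Finset.sum_nonneg fun j _ => abs_nonneg _
  have hmin : ∑ i, |r i| ≤ ∑ i, |x i| := by
    simpa only [l1norm_eq] using hR2 x rfl
  have hhead : ∑ i ∈ S, |h i| ≤ L / 4 := by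
    apply le_of_sq_le_sq _ (by positivity)
    have h1 : (∑ i ∈ S, |h i|) ^ 2 ≤ S.card * ∑ i ∈ S, |h i| ^ 2 := sq_sum_le_card_mul_sum_sq
    have h2 : ∑ i ∈ S, |h i| ^ 2 ≤ ∑ i, h i ^ 2 := by
      simp only [sq_abs]
      exact Finset.sum_le_sum_of_subset_of_nonneg (Finset.subset_univ _) fun i _ _ => sq_nonneg _
    rw [card_head x hkn] at h1
    have h3 := mul_le_mul_of_nonneg_left h2 (Nat.cast_nonneg (α := ℝ) k)
    linarith
  rw [l1norm_tailVec]
  set T := ∑ i ∈ Sᶜ, |x i|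
  -- Minimality gives `L ≤ 2 ∑ i ∈ S, |h i| + 2 T ≤ L / 2 + 2 T`.
  have hLT : L ≤ 4 * T := by
    rw [← Finset.sum_add_sum_compl S, ← Finset.sum_add_sum_compl S fun i => |x i|] at hmin
    have hsplit : L = ∑ i ∈ S, |h i| + ∑ i ∈ Sᶜ, |h i| := (Finset.sum_add_sum_compl S _).symm
    have h1 : ∑ i ∈ S, |x i| ≤ ∑ i ∈ S, |h i| + ∑ i ∈ S, |r i| := by
      rw [← Finset.sum_add_distrib]
      refine Finset.sum_le_sum fun i _ => ?_
      have : x i = h i + r i := by simp [hh]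
      rw [this]
      exact abs_add_le _ _
    have h2 : ∑ i ∈ Sᶜ, |h i| ≤ T + ∑ i ∈ Sᶜ, |r i| := by
      rw [← Finset.sum_add_distrib]
      exact Finset.sum_le_sum fun i _ => abs_sub _ _
    linarith
  apply le_of_sq_le_sq _ (by linarith)
  rw [mul_pow, Real.sq_sqrt (Nat.cast_nonneg k), l2norm_sq]
  nlinarith

/-! ### Inner products and choice of constants -/

/-- Inner products are estimated well from approximations of the two vectors. -/
theorem abs_dotProduct_sub_dotProduct_le {n : ℕ} {x y x' y' : Fin n → ℝ} {a b : ℝ}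
    (hx : l2norm (x - x') ≤ a) (hy : l2norm (y - y') ≤ b) :
    |x' ⬝ᵥ y' - x ⬝ᵥ y| ≤ l2norm x * b + a * l2norm y + a * b := by
  have e : x' ⬝ᵥ y' - x ⬝ᵥ y =
      -(x ⬝ᵥ (y - y')) - (x - x') ⬝ᵥ y + (x - x') ⬝ᵥ (y - y') := by
    simp only [sub_dotProduct, dotProduct_sub]
    ring
  have h1 := (abs_dotProduct_le_l2norm_mul x (y - y')).trans
    (mul_le_mul_of_nonneg_left hy (l2norm_nonneg x))
  have h2 := (abs_dotProduct_le_l2norm_mul (x - x') y).trans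
    (mul_le_mul_of_nonneg_right hx (l2norm_nonneg y))
  have h3 := (abs_dotProduct_le_l2norm_mul (x - x') (y - y')).trans
    (mul_le_mul hx hy (l2norm_nonneg _) ((l2norm_nonneg _).trans hx))
  rw [e]
  rw [abs_le] at *
  constructor <;> linarith

/-- Inner product estimation with the `⌈1/ε²⌉`-tail guarantee from `O(ε⁻² log n)` linear
measurements; the estimate is the inner product of the outputs of an `ℓ₂/ℓ₁` sparse recovery. -/
theorem mainTheorem9 :
    ∃ C : ℝ, 0 < C ∧ ∀ (n : ℕ) (ε : ℝ), 0 < ε → ε < 1 / 2 → 1 / ε ^ 2 < (n : ℝ) / 2 →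
      ∃ (m : ℕ) (A : Matrix (Fin m) (Fin n) ℝ) (R : (Fin m → ℝ) → (Fin n → ℝ)),
        (m : ℝ) ≤ C * (1 / ε ^ 2) * Real.log (n : ℝ) ∧
        IsL1MinRecovery A R ∧
        (∀ x : Fin n → ℝ,
          l2norm (x - R (A *ᵥ x)) ≤ ε * l1norm (tailVec x ⌈1 / ε ^ 2⌉₊)) ∧
        ∀ x y : Fin n → ℝ,
          |R (A *ᵥ x) ⬝ᵥ R (A *ᵥ y) - x ⬝ᵥ y| ≤
            ε * (l2norm x * l1norm (tailVec y ⌈1 / ε ^ 2⌉₊) +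
                l1norm (tailVec x ⌈1 / ε ^ 2⌉₊) * l2norm y) +
              ε ^ 2 * (l1norm (tailVec x ⌈1 / ε ^ 2⌉₊) * l1norm (tailVec y ⌈1 / ε ^ 2⌉₊)) := by
  refine ⟨40000, by norm_num, fun n ε hε hε2 hn => ?_⟩
  set q : ℝ := 1 / ε ^ 2 with hq
  have hq4 : 4 < q := by
    rw [hq, lt_div_iff₀ (by positivity)]
    nlinarith
  set k := ⌈q⌉₊ with hk
  have hkq : q ≤ k := Nat.le_ceil q
  have hkq' : (k : ℝ) < q + 1 := Nat.ceil_lt_add_one (by linarith)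
  have hn8 : (8 : ℝ) < n := by linarith
  have hk0 : 0 < k := by
    have : (0 : ℝ) < k := by linarith
    exact_mod_cast this
  have hkn : k ≤ n := by
    have : (k : ℝ) ≤ n := by linarith
    exact_mod_cast this
  have hn0 : 0 < n := hk0.trans_le hkn
  have hlog1 : 1 ≤ Real.log n := by
    rw [Real.le_log_iff_exp_le (by linarith)]
    linarith [Real.exp_one_lt_d9]
  have hlog2 : Real.log (2 * n) ≤ 2 * Real.log n := by
    rw [Real.log_mul (by norm_num) (by linarith)]
    linarith [Real.log_le_log (by norm_num) (show (2 : ℝ) ≤ n by linarith)]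
  have hlog0 : 0 < Real.log (2 * n) := Real.log_pos (by linarith)
  -- `640 = 40 * 16` turns the kernel bound into the constant `16` needed for recovery.
  set s := 640 * k with hs
  set m := ⌈12 * (s * Real.log (2 * n))⌉₊ with hm
  have hsR : (s : ℝ) = 640 * k := by simp [hs]
  have hms : 12 * (s * Real.log (2 * n)) ≤ m := Nat.le_ceil _
  have hm0 : 0 < m := by
    apply Nat.ceil_pos.mpr
    have : (0 : ℝ) < s := by rw [hsR]; positivity
    positivity
  have hmC : (m : ℝ) ≤ 40000 * q * Real.log n := by
    have h1 : (m : ℝ) < 12 * (s * Real.log (2 * n)) + 1 := Nat.ceil_lt_add_one (by positivity)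
    -- Since `q > 4`, `k < q + 1 < 5 q / 4`, so `s ≤ 800 q`.
    have h2 : (s : ℝ) * Real.log (2 * n) ≤ (800 * q) * (2 * Real.log n) := by
      apply mul_le_mul _ hlog2 hlog0.le (by positivity)
      rw [hsR]
      linarith
    have h3 : 1 ≤ q * Real.log n := by nlinarith
    linarith
  obtain ⟨σ, hσ⟩ := exists_signMatrix_kernel (s := s) hm0 hn0 (by linarith)
  obtain ⟨R, hR⟩ := exists_isL1MinRecovery (signMatrix σ)
  have hker : ∀ h : Fin n → ℝ, signMatrix σ *ᵥ h = 0 →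
      16 * k * ∑ j, h j ^ 2 ≤ (∑ j, |h j|) ^ 2 := by
    intro h hh
    have h1 := hσ h hh
    rw [hsR] at h1
    linarith
  have hrec : ∀ x : Fin n → ℝ,
      l2norm (x - R (signMatrix σ *ᵥ x)) ≤ ε * l1norm (tailVec x k) := by
    intro x
    have h1 := l2norm_sub_recovery_le hR hkn hker x
    have h2 : 1 ≤ ε * √k := by
      have h3 : 1 / ε ≤ √k := Real.le_sqrt_of_sq_le (by rw [div_pow, one_pow]; exact hkq)
      rwa [div_le_iff₀' hε] at h3
    calc l2norm (x - R (signMatrix σ *ᵥ x))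
        ≤ ε * √k * l2norm (x - R (signMatrix σ *ᵥ x)) :=
          le_mul_of_one_le_left (l2norm_nonneg _) h2
      _ ≤ ε * l1norm (tailVec x k) := by
          rw [mul_assoc]
          exact mul_le_mul_of_nonneg_left h1 hε.le
  refine ⟨m, signMatrix σ, R, hmC, hR, hrec, fun x y => ?_⟩
  refine (abs_dotProduct_sub_dotProduct_le (hrec x) (hrec y)).trans (le_of_eq ?_)
  ring
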